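/- Spaces are Hausdorff. A space $X$ is of Type I if it is not Lindelöf and $X=\bigcup_{\alpha<\omega_1}X_\alpha$ with each $X_\alpha$ open, each closure $\overline{X_\alpha}$ Lindelöf, and $\overline{X_\alpha}\subset X_\beta$ whenever $\alpha<\beta<\omega_1$. A subset of $X$ is bounded if it is contained in some $X_\alpha$ (this does not depend on the choice of the sequence $\langle X_\alpha\rangle$), and club if it is closed and unbounded. Let $\mathbb L_{\ge 0}=\omega_1\times[0,1)$, with the lexicographic order topology, be the closed long ray. For $A,B\subset X$ write $A\preceq B$ if every continuous $f:X\to\mathbb L_{\ge0}$ that is unbounded on $A$ is unbounded on $B$. A direction in $X$ is a club set $D\subset X$ such that $C\preceq D$ and $D\preceq C$ for every club set $C\subset D$. A space is $\omega_1$-compact if it has no uncountable closed discrete subset. A surface is a connected Hausdorff space in which every point has an open neighbourhood homeomorphic to $\mathbb R^2$. A Suslin tree is a tree of cardinality $\aleph_1$ all of whose chains and antichains are countable. **Theorem 3.5.** If there is a Suslin tree (i.e. if the Suslin hypothesis fails), then there is an $\omega_1$-compact Type I surface that contains no direction. -/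

import Mathlib

open Ordinal

/-- A tree: a partial order in which the set of strict predecessors of each element is
well-ordered. -/
def IsTreeOrder (T : Type*) [PartialOrder T] : Prop :=
  ∀ x : T, IsWellOrder (Set.Iio x) (· < ·)

/-- A Suslin tree: a tree of cardinality `ℵ₁` all of whose chains and antichains are countable. -/
structure IsSuslinTree (T : Type*) [PartialOrder T] : Prop where
  isTree : IsTreeOrder T
  card_eq : Cardinal.mk T = Cardinal.aleph 1
  countable_of_isChain : ∀ C : Set T, IsChain (· ≤ ·) C → C.Countable
  countable_of_isAntichain : ∀ A : Set T, IsAntichain (· ≤ ·) A → A.Countable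

/-- The Suslin hypothesis: there is no Suslin tree. (As a Suslin tree has cardinality `ℵ₁`, it is
isomorphic to one whose underlying type is in the lowest universe.) -/
def SuslinHypothesis : Prop :=
  ¬ ∃ (T : Type) (_ : PartialOrder T), IsSuslinTree T

/-- The countable ordinals. -/
abbrev CountableOrdinal : Type 1 := Set.Iio (ω₁ : Ordinal.{0})

/-- The closed long ray: `ω₁ × [0, 1)` with the lexicographic order and its order topology. -/
def LongRay : Type 1 := CountableOrdinal ×ₗ Set.Ico (0 : ℝ) 1

noncomputable instance : LinearOrder LongRay :=
  inferInstanceAs (LinearOrder (CountableOrdinal ×ₗ Set.Ico (0 : ℝ) 1))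

noncomputable instance : TopologicalSpace LongRay := Preorder.topology LongRay

instance : OrderTopology LongRay := ⟨rfl⟩

section TypeI

variable {X : Type*} [TopologicalSpace X]

/-- The sequence `⟨U α : α < ω₁⟩` exhibits `X` as a (non-Lindelöf) Type I space. -/
structure IsTypeISequence (U : CountableOrdinal → Set X) : Prop where
  isOpen : ∀ α, IsOpen (U α)
  isLindelof_closure : ∀ α, IsLindelof (closure (U α))
  closure_subset : ∀ α β, α < β → closure (U α) ⊆ U β
  iUnion_eq : ⋃ α, U α = Set.univ
  not_lindelofSpace : ¬ LindelofSpace X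

/-- A subset of a Type I space is bounded if it is contained in some member of the sequence. -/
def IsBoundedIn (U : CountableOrdinal → Set X) (A : Set X) : Prop :=
  ∃ α, A ⊆ U α

/-- Closed and unbounded subsets of a Type I space. -/
def IsClubIn (U : CountableOrdinal → Set X) (A : Set X) : Prop :=
  IsClosed A ∧ ¬ IsBoundedIn U A

/-- The unbounded function order on the subsets of `X`: every continuous map to the long ray that
is unbounded on `A` is unbounded on `B`. -/
def UfoLE (A B : Set X) : Prop :=
  ∀ f : X → LongRay, Continuous f → ¬ BddAbove (f '' A) → ¬ BddAbove (f '' B)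

/-- A direction: a club subset which is ufo-equivalent to each of its club subsets. -/
def IsDirection (U : CountableOrdinal → Set X) (D : Set X) : Prop :=
  IsClubIn U D ∧ ∀ C, C ⊆ D → IsClubIn U C → UfoLE C D ∧ UfoLE D C

end TypeI

/-- A space is a Type I space if it admits a sequence as above. -/
def IsTypeISpace (X : Type*) [TopologicalSpace X] : Prop :=
  ∃ U : CountableOrdinal → Set X, IsTypeISequence U

/-- A space is `ω₁`-compact if it has no uncountable closed discrete subset. -/
def IsOmegaOneCompact (X : Type*) [TopologicalSpace X] : Prop :=
  ∀ E : Set X, IsClosed E → DiscreteTopology E → E.Countable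

/-- A surface: a connected Hausdorff space in which every point has an open neighbourhood
homeomorphic to the plane. (No second countability or metrizability is required.) -/
structure IsSurface (X : Type*) [TopologicalSpace X] : Prop where
  t2Space : T2Space X
  connectedSpace : ConnectedSpace X
  locally_plane : ∀ x : X, ∃ V : Set X, IsOpen V ∧ x ∈ V ∧
    Nonempty (V ≃ₜ EuclideanSpace ℝ (Fin 2))

/-! Over a Suslin tree with one root and unique limits, every node carries a strip `[0, 1) × ℝ`. The
strips below a node `t` are stacked into a plane, the chart of `t`. The strip of `s < t` enters it
through the shear `x ↦ x + c * slope y`, where `c ∈ [0, 1]` labels the immediate successor of `s`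
below `t`. Distinct successors have distinct labels and `slope y → ∞` as `y → 1`, so branches that
split at `s` are driven infinitely far apart. This makes the space Hausdorff (`t2Space`), and the
height map to the long ray makes it Type I.

A set meeting uncountably many strips accumulates: one integer bounds `fib` and `slope` on
uncountably many of them, some node `b` has such strips cofinally below it (`exists_node_cofinal`),
and bounded labels keep their coordinates bounded in the chart of `b`. With second countability of
the charts, this gives `ω₁`-compactness.

Suppose `D` is a direction. By `exists_incomparable`, `D` meets uncountably many strips above each
of two incomparable nodes `q₀`, `q₁`. Deleting the points comparable with `q₀` leaves a club `C ⊆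
D`, yet `coneHeight q₀` is unbounded on `D` and constant on `C`.

An arbitrary Suslin tree is first replaced by the tree of its initial segments
(`SegmentTree.hausdorffSuslinTree`). -/

/-! ### Countable ordinals. -/

namespace CountableOrdinal

theorem countable_Iio (α : CountableOrdinal) : (Set.Iio α).Countable := by
  have h1 : (α : Ordinal.{0}).card < Cardinal.aleph 1 := Cardinal.lt_ord.1 (by
    rw [Cardinal.ord_aleph]
    exact α.2)
  have h2 : (Set.Iio (α : Ordinal.{0})).Countable := by
    rw [← Cardinal.le_aleph0_iff_set_countable, Cardinal.mk_Iio_ordinal, Cardinal.lift_le_aleph0]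
    rwa [← Cardinal.succ_aleph0, Order.lt_succ_iff] at h1
  have h3 := h2.preimage (f := (Subtype.val : CountableOrdinal → Ordinal)) Subtype.val_injective
  exact h3.mono fun β hβ => hβ

/-- The successor of a countable ordinal. -/
noncomputable def next (α : CountableOrdinal) : CountableOrdinal :=
  ⟨Order.succ α.1, (Cardinal.isSuccLimit_omega 1).succ_lt α.2⟩

theorem lt_next (α : CountableOrdinal) : α < α.next := Order.lt_succ α.1

theorem lt_next_iff {α β : CountableOrdinal} : α < β.next ↔ α ≤ β :=
  Order.lt_succ_iff (a := α.1) (b := β.1)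

theorem next_le_iff {α β : CountableOrdinal} : α.next ≤ β ↔ α < β :=
  Order.succ_le_iff (a := α.1) (b := β.1)

/-- The ordinal zero. -/
noncomputable def zero : CountableOrdinal := ⟨0, Ordinal.omega_pos 1⟩

theorem zero_le (α : CountableOrdinal) : zero ≤ α := bot_le (a := α.1)

theorem exists_forall_lt_of_countable {ι : Type*} [Countable ι] (f : ι → CountableOrdinal) :
    ∃ β, ∀ i, f i < β := by
  by_contra! hc
  have h1 : (⋃ i, Set.Iic (f i)) = Set.univ :=
    Set.eq_univ_of_forall fun β => Set.mem_iUnion.2 (hc β)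
  have h2 : (⋃ i, Set.Iic (f i)).Countable := Set.countable_iUnion fun i =>
    (countable_Iio (f i).next).mono fun _ h => lt_next_iff.2 h
  rw [h1, Set.countable_univ_iff, ← Cardinal.mk_le_aleph0_iff] at h2
  rw [Cardinal.mk_Iio_ordinal, Cardinal.lift_le_aleph0, ← Cardinal.ord_aleph, Cardinal.card_ord] at h2
  exact h2.not_gt Cardinal.aleph0_lt_aleph_one

end CountableOrdinal

/-! ### The long ray and its block coordinates. -/

namespace LongRay

/-- The point of the long ray with the given coordinates. -/
def mk (α : CountableOrdinal) (y : Set.Ico (0 : ℝ) 1) : LongRay := toLex (α, y)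

/-- The ordinal coordinate. -/
def level (q : LongRay) : CountableOrdinal := (ofLex (α := CountableOrdinal × Set.Ico (0 : ℝ) 1) q).1

/-- The real coordinate. -/
def frac (q : LongRay) : Set.Ico (0 : ℝ) 1 := (ofLex (α := CountableOrdinal × Set.Ico (0 : ℝ) 1) q).2

@[simp] theorem level_mk (α : CountableOrdinal) (y : Set.Ico (0 : ℝ) 1) : (mk α y).level = α := rfl

@[simp] theorem frac_mk (α : CountableOrdinal) (y : Set.Ico (0 : ℝ) 1) : (mk α y).frac = y := rfl

@[simp] theorem mk_level_frac (q : LongRay) : mk q.level q.frac = q := rfl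

theorem lt_iff {p q : LongRay} :
    p < q ↔ p.level < q.level ∨ p.level = q.level ∧ (p.frac : ℝ) < q.frac :=
  Prod.Lex.lt_iff (α := CountableOrdinal) (β := Set.Ico (0 : ℝ) 1) (x := p) (y := q)

theorem le_iff {p q : LongRay} :
    p ≤ q ↔ p.level < q.level ∨ p.level = q.level ∧ (p.frac : ℝ) ≤ q.frac :=
  Prod.Lex.le_iff (α := CountableOrdinal) (β := Set.Ico (0 : ℝ) 1) (x := p) (y := q)

/-- The point of the long ray corresponding to a countable ordinal. -/
noncomputable def base (α : CountableOrdinal) : LongRay := mk α ⟨0, by simp⟩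

@[simp] theorem level_base (α : CountableOrdinal) : (base α).level = α := rfl

@[simp] theorem frac_base (α : CountableOrdinal) : ((base α).frac : ℝ) = 0 := rfl

theorem lt_base_iff {q : LongRay} {α : CountableOrdinal} : q < base α ↔ q.level < α := by
  rw [lt_iff]
  have := q.frac.2.1
  constructor
  · rintro (h | ⟨-, h⟩)
    · exact h
    · exact absurd this (not_le.2 h)
  · exact Or.inl

theorem base_le_iff {q : LongRay} {α : CountableOrdinal} : base α ≤ q ↔ α ≤ q.level := by
  rw [← not_lt, lt_base_iff, not_lt]

theorem base_lt_base {α β : CountableOrdinal} : base α < base β ↔ α < β := lt_base_iff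

/-- The retraction of the long ray onto the closure of the block with index `α`. -/
noncomputable def clamp (α : CountableOrdinal) (q : LongRay) : ℝ :=
  if q.level < α then 0 else if q.level = α then q.frac else 1

theorem clamp_of_lt {α : CountableOrdinal} {q : LongRay} (h : q.level < α) : clamp α q = 0 :=
  if_pos h

theorem clamp_of_eq {α : CountableOrdinal} {q : LongRay} (h : q.level = α) :
    clamp α q = q.frac := by
  simp [clamp, h]

theorem clamp_mk (α : CountableOrdinal) (y : Set.Ico (0 : ℝ) 1) : clamp α (mk α y) = y :=
  clamp_of_eq rfl

theorem clamp_base (α : CountableOrdinal) : clamp α (base α) = 0 :=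
  clamp_of_eq rfl

theorem clamp_of_gt {α : CountableOrdinal} {q : LongRay} (h : α < q.level) : clamp α q = 1 := by
  simp [clamp, h.not_gt, h.ne']

theorem clamp_mem (α : CountableOrdinal) (q : LongRay) : clamp α q ∈ Set.Icc (0 : ℝ) 1 := by
  rcases lt_trichotomy q.level α with h | h | h
  · simp [clamp_of_lt h]
  · rw [clamp_of_eq h]
    exact ⟨q.frac.2.1, q.frac.2.2.le⟩
  · simp [clamp_of_gt h]

theorem clamp_lt_one {α : CountableOrdinal} {q : LongRay} (h : q.level ≤ α) : clamp α q < 1 := by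
  rcases h.lt_or_eq with h | h
  · simp [clamp_of_lt h]
  · rw [clamp_of_eq h]
    exact q.frac.2.2

theorem clamp_mono (α : CountableOrdinal) : Monotone (clamp α) := by
  intro p q h
  rcases lt_trichotomy p.level α with hp | hp | hp
  · rw [clamp_of_lt hp]
    exact (clamp_mem α q).1
  · rcases le_iff.1 h with h | ⟨h, h'⟩
    · rw [clamp_of_gt (q := q) (by rwa [← hp])]
      exact (clamp_mem α p).2
    · rwa [clamp_of_eq hp, clamp_of_eq (h.symm.trans hp)]
  · rw [clamp_of_gt (α := α) (q := q)]
    · exact (clamp_mem α p).2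
    · rcases le_iff.1 h with h | ⟨h, -⟩
      · exact hp.trans h
      · exact h ▸ hp

/-- A monotone map onto `[0, 1]` is continuous. -/
theorem continuous_clamp (α : CountableOrdinal) : Continuous (clamp α) := by
  have h : Continuous fun q => (⟨clamp α q, clamp_mem α q⟩ : Set.Icc (0 : ℝ) 1) := by
    refine Monotone.continuous_of_surjective (fun p q hpq => clamp_mono α hpq) ?_
    rintro ⟨y, hy0, hy1⟩
    rcases hy1.lt_or_eq with h | h
    · exact ⟨mk α ⟨y, hy0, h⟩, Subtype.ext (clamp_of_eq rfl)⟩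
    · exact ⟨base α.next, Subtype.ext ((clamp_of_gt α.lt_next).trans h.symm)⟩
  exact continuous_subtype_val.comp h

theorem exists_clamp_lt {p q : LongRay} (h : p < q) : clamp p.level p < clamp p.level q := by
  rw [clamp_of_eq rfl]
  rcases lt_iff.1 h with h | ⟨h, h'⟩
  · rw [clamp_of_gt h]
    exact p.frac.2.2
  · rwa [clamp_of_eq h.symm]

/-! ### Countable initial intervals of the long ray are real intervals. -/

section Parametrization

variable {β : CountableOrdinal}

theorem exists_weight (β : CountableOrdinal) :
    ∃ v : Set.Iio β → ℝ, (∀ γ, 0 < v γ) ∧ Summable v := by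
  have := (CountableOrdinal.countable_Iio β).to_subtype
  obtain ⟨n, hn⟩ := exists_injective_nat (Set.Iio β)
  exact ⟨fun γ => (1 / 2 : ℝ) ^ n γ, fun γ => by positivity,
    summable_geometric_two.comp_injective hn⟩

/-- A continuous real function on the long ray, strictly increasing up to `base β`. -/
noncomputable def param (v : Set.Iio β → ℝ) (q : LongRay) : ℝ := ∑' γ, v γ * clamp γ.1 q

variable {v : Set.Iio β → ℝ}

theorem summable_param (hv : ∀ γ, 0 < v γ) (hs : Summable v) (q : LongRay) : Summable fun γ => v γ * clamp γ.1 q :=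
  Summable.of_nonneg_of_le (fun γ => mul_nonneg (hv γ).le (clamp_mem _ _).1)
    (fun γ => mul_le_of_le_one_right (hv γ).le (clamp_mem _ _).2) hs

theorem continuous_param (hv : ∀ γ, 0 < v γ) (hs : Summable v) : Continuous (param v) := by
  refine continuous_tsum (fun γ => continuous_const.mul (continuous_clamp γ.1)) hs fun γ q => ?_
  rw [Real.norm_of_nonneg (mul_nonneg (hv γ).le (clamp_mem _ _).1)]
  exact mul_le_of_le_one_right (hv γ).le (clamp_mem _ _).2

/-- All summands are monotone, and the one indexed by the block of the smaller point increases
strictly. -/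
theorem param_strictMonoOn (hv : ∀ γ, 0 < v γ) (hs : Summable v) : StrictMonoOn (param v) (Set.Iic (base β)) := by
  intro p _ q hq h
  have hp : p.level < β := lt_base_iff.1 (h.trans_le hq)
  refine Summable.tsum_lt_tsum (i := ⟨p.level, hp⟩)
    (fun γ => mul_le_mul_of_nonneg_left (clamp_mono _ h.le) (hv γ).le)
    (mul_lt_mul_of_pos_left (exists_clamp_lt h) (hv _))
    (summable_param hv hs p) (summable_param hv hs q)

theorem param_eq_add (hv : ∀ γ, 0 < v γ) (hs : Summable v) (γ : Set.Iio β) {p q : LongRay}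
    (h : ∀ δ : Set.Iio β, δ ≠ γ → clamp δ p = clamp δ q) :
    param v q = param v p + v γ * (clamp γ q - clamp γ p) := by
  have h1 := (summable_param hv hs p).hasSum.add
    (hasSum_ite_eq γ (v γ * (clamp γ q - clamp γ p)))
  refine (summable_param hv hs q).hasSum.unique ?_
  convert h1 using 1
  ext δ
  by_cases hδ : δ = γ
  · subst hδ
    simp only [if_true]
    ring
  · simp [hδ, h δ hδ]
  · rfl

theorem param_mk (hv : ∀ γ, 0 < v γ) (hs : Summable v) (γ : Set.Iio β) (y : Set.Ico (0 : ℝ) 1) :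
    param v (mk γ y) = param v (base γ) + v γ * y := by
  have h := param_eq_add hv hs γ (p := base γ) (q := mk γ y) fun δ hδ => by
    rcases lt_or_gt_of_ne (Subtype.coe_injective.ne hδ) with h | h
    · rw [clamp_of_gt (by exact h), clamp_of_gt (by exact h)]
    · rw [clamp_of_lt (by exact h), clamp_of_lt (by exact h)]
  rw [h, clamp_mk, clamp_base, _root_.sub_zero]

theorem param_base_next (hv : ∀ γ, 0 < v γ) (hs : Summable v) (γ : Set.Iio β) :
    param v (base γ.1.next) = param v (base γ) + v γ := by
  have h := param_eq_add hv hs γ (p := base γ) (q := base γ.1.next) fun δ hδ => by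
    rcases lt_or_gt_of_ne (Subtype.coe_injective.ne hδ) with h | h
    · rw [clamp_of_gt (by exact h), clamp_of_gt (by exact h.trans γ.1.lt_next)]
    · rw [clamp_of_lt (by exact h)]
      rcases (CountableOrdinal.next_le_iff.2 h).lt_or_eq with h' | h'
      · rw [clamp_of_lt (by exact h')]
      · rw [clamp_of_eq (by exact h')]
        simp
  rw [h, clamp_of_gt (q := base γ.1.next) γ.1.lt_next, clamp_base, _root_.sub_zero, mul_one]

theorem param_zero (v : Set.Iio β → ℝ) : param v (base CountableOrdinal.zero) = 0 := by
  refine (tsum_congr fun γ => ?_).trans tsum_zero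
  rcases (CountableOrdinal.zero_le γ.1).lt_or_eq with h | h
  · rw [clamp_of_lt (by exact h), mul_zero]
  · rw [clamp_of_eq (by exact h)]
    simp

/-- The first block boundary with value above `r` cannot be a limit, by continuity; so `r` is
attained in the block just before it, where `param v` is affine. -/
theorem exists_param_eq (hv : ∀ γ, 0 < v γ) (hs : Summable v) {r : ℝ} (h0 : 0 ≤ r) (h1 : r < param v (base β)) :
    ∃ q < base β, param v q = r := by
  have hne : {γ : CountableOrdinal | r < param v (base γ)}.Nonempty := ⟨β, h1⟩
  obtain ⟨γ, hγ, hmin⟩ := WellFounded.has_min (wellFounded_lt (α := CountableOrdinal)) _ hne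
  have hγβ : γ ≤ β := not_lt.1 fun h => hmin β h1 h
  have hz : param v (base CountableOrdinal.zero) = 0 := param_zero v
  have hγ0 : base CountableOrdinal.zero < base γ := by
    rw [base_lt_base]
    refine (CountableOrdinal.zero_le γ).lt_of_ne ?_
    rintro rfl
    exact absurd hγ (by simp [hz, h0])
  obtain ⟨q, hq, hqγ⟩ := exists_Ioc_subset_of_mem_nhds
    ((continuous_param hv hs).isOpen_preimage _ isOpen_Ioi |>.mem_nhds hγ) ⟨_, hγ0⟩
  have hqβ : q.level < β := (lt_base_iff.1 hq).trans_le hγβ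
  have hle : param v (base q.level) ≤ r := not_lt.1 fun h => hmin _ h (lt_base_iff.1 hq)
  have hγn : γ = q.level.next := by
    by_contra hne
    have hlt : q.level.next < γ :=
      lt_of_le_of_ne (CountableOrdinal.next_le_iff.2 (lt_base_iff.1 hq)) (Ne.symm hne)
    refine hmin _ (hqγ ⟨?_, (base_lt_base.2 hlt).le⟩) hlt
    rw [lt_base_iff]
    exact q.level.lt_next
  have hstep : param v (base γ) = param v (base q.level) + v ⟨q.level, hqβ⟩ := by
    rw [hγn]
    exact param_base_next hv hs ⟨q.level, hqβ⟩
  have hpos := hv ⟨q.level, hqβ⟩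
  have hγ' : r < param v (base γ) := hγ
  refine ⟨mk q.level ⟨(r - param v (base q.level)) / v ⟨q.level, hqβ⟩, ?_, ?_⟩,
    lt_base_iff.2 hqβ, ?_⟩
  · exact div_nonneg (sub_nonneg.2 hle) hpos.le
  · rw [div_lt_one hpos]
    linarith
  · have := param_mk hv hs ⟨q.level, hqβ⟩
      ⟨(r - param v (base q.level)) / v ⟨q.level, hqβ⟩,
        div_nonneg (sub_nonneg.2 hle) hpos.le, by rw [div_lt_one hpos]; linarith⟩
    rw [this, mul_div_cancel₀ _ hpos.ne']
    ring

theorem image_param (hv : ∀ γ, 0 < v γ) (hs : Summable v) :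
    param v '' Set.Ioo (base CountableOrdinal.zero) (base β) = Set.Ioo 0 (param v (base β)) := by
  have hmono := param_strictMonoOn hv hs
  ext r
  constructor
  · rintro ⟨q, ⟨h0, h1⟩, rfl⟩
    refine ⟨?_, hmono h1.le Set.self_mem_Iic h1⟩
    have := hmono (h0.trans h1).le h1.le h0
    rwa [param_zero] at this
  · rintro ⟨h0, h1⟩
    obtain ⟨q, hq, rfl⟩ := exists_param_eq hv hs h0.le h1
    refine ⟨q, ⟨?_, hq⟩, rfl⟩
    rw [← param_zero v] at h0
    exact (hmono.lt_iff_lt (base_le_iff.2 (CountableOrdinal.zero_le β)) hq.le).1 h0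

/-- Bounded open initial intervals of the open long ray are homeomorphic to the line. -/
theorem nonempty_homeomorph_Ioo (hβ : CountableOrdinal.zero < β) :
    Nonempty (Set.Ioo (base CountableOrdinal.zero) (base β) ≃ₜ ℝ) := by
  obtain ⟨v, hv, hs⟩ := exists_weight β
  have hmono := (param_strictMonoOn hv hs).mono
    (Set.Ioo_subset_Iio_self.trans Set.Iio_subset_Iic_self :
      Set.Ioo (base CountableOrdinal.zero) (base β) ⊆ _)
  have hpos : 0 < param v (base β) := by
    have := param_strictMonoOn hv hs (base_lt_base.2 hβ).le Set.self_mem_Iic (base_lt_base.2 hβ)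
    rwa [param_zero] at this
  have e1 := hmono.orderIso.trans (OrderIso.setCongr _ _ (image_param hv hs))
  have e2 : Set.Ioo (0 : ℝ) (param v (base β)) ≃ₜ ℝ := by
    have h := affineHomeomorph_image_Ioo (param v (base β) / 2) (param v (base β) / 2) (-1) 1
      (half_pos hpos)
    rw [show param v (base β) / 2 * -1 + param v (base β) / 2 = 0 by ring,
      show param v (base β) / 2 * 1 + param v (base β) / 2 = param v (base β) by ring] at h
    exact ((orderIsoIooNegOneOne ℝ).toHomeomorph.trans
      (((affineHomeomorph _ _ (half_pos hpos).ne').image _).trans (Homeomorph.setCongr h))).symm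
  exact ⟨e1.toHomeomorph.trans e2⟩

end Parametrization

end LongRay

/-! ### Heights, meets and labels in a Suslin tree. -/

/-- A Suslin tree (of arbitrary uncountable size) with a single root and unique limits. -/
class HausdorffSuslinTree (T : Type) [PartialOrder T] : Prop where
  wellFoundedLT : WellFoundedLT T
  le_or_le : ∀ {a b c : T}, a ≤ c → b ≤ c → a ≤ b ∨ b ≤ a
  exists_isGreatest : ∀ {a b : T}, Set.Iio a = Set.Iio b → a ≠ b → ∃ s, IsGreatest (Set.Iio a) s
  uncountable : Uncountable T
  countable_of_isChain : ∀ C : Set T, IsChain (· ≤ ·) C → C.Countable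
  countable_of_isAntichain : ∀ A : Set T, IsAntichain (· ≤ ·) A → A.Countable
  exists_label : ∃ w : T → ℝ, Function.Injective w ∧ ∀ t, w t ∈ Set.Icc (0 : ℝ) 1

namespace HausdorffSuslinTree

variable {T : Type} [PartialOrder T] [HausdorffSuslinTree T]

instance : WellFoundedLT T := wellFoundedLT

theorem countable_Iic (t : T) : (Set.Iic t).Countable :=
  countable_of_isChain _ fun _ ha _ hb _ => le_or_le ha hb

theorem rank_lt_omega_one (t : T) : IsWellFounded.rank (· < ·) t < (ω₁ : Ordinal.{0}) := by
  induction t using WellFoundedLT.induction with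
  | ind t ih =>
    have : Countable {s // s < t} := ((countable_Iic t).mono fun s hs => le_of_lt hs).to_subtype
    rw [IsWellFounded.rank_eq]
    exact Ordinal.iSup_lt_omega_one fun s =>
      (Cardinal.isSuccLimit_omega 1).succ_lt (ih s.1 s.2)

/-- The height of a node. -/
noncomputable def ht (t : T) : CountableOrdinal := ⟨IsWellFounded.rank (· < ·) t, rank_lt_omega_one t⟩

theorem ht_strictMono : StrictMono (ht : T → CountableOrdinal) := fun _ _ h =>
  IsWellFounded.rank_lt_of_rel (r := (· < · : T → T → Prop)) h

theorem exists_le_ht_eq {t : T} {γ : CountableOrdinal} (h : γ ≤ ht t) : ∃ s ≤ t, ht s = γ := by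
  induction t using WellFoundedLT.induction with
  | ind t ih =>
    rcases h.lt_or_eq with h | h
    · have h' : γ.1 < IsWellFounded.rank (· < ·) t := h
      rw [IsWellFounded.rank_eq, Ordinal.lt_iSup_iff] at h'
      obtain ⟨s, hs⟩ := h'
      obtain ⟨r, hr, hrγ⟩ := ih s.1 s.2 (Order.lt_succ_iff.1 hs : γ.1 ≤ (ht s.1).1)
      exact ⟨r, hr.trans s.2.le, hrγ⟩
    · exact ⟨t, le_rfl, h.symm⟩

theorem le_of_ht_le {a b c : T} (ha : a ≤ c) (hb : b ≤ c) (h : ht a ≤ ht b) : a ≤ b := by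
  rcases le_or_le ha hb with h' | h'
  · exact h'
  · rcases h'.lt_or_eq with h' | h'
    · exact absurd (ht_strictMono h') h.not_gt
    · exact h'.ge

theorem lt_of_ht_lt {a b c : T} (ha : a ≤ c) (hb : b ≤ c) (h : ht a < ht b) : a < b :=
  (le_of_ht_le ha hb h.le).lt_of_ne fun h' => h.ne (congrArg ht h')

theorem exists_minimal_le {P : T → Prop} {t : T} (h : P t) : ∃ m ≤ t, Minimal P m := by
  obtain ⟨m, hm, hmin⟩ := WellFounded.has_min (wellFounded_lt (α := T)) {s | s ≤ t ∧ P s}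
    ⟨t, le_rfl, h⟩
  refine ⟨m, hm.1, hm.2, fun s hs hsm => ?_⟩
  by_contra hc
  exact hmin s ⟨hsm.trans hm.1, hs⟩ (lt_of_le_not_ge hsm hc)

/-- For incomparable `s`, `t`, let `a` be the first node below `s` but not below `t`, and `b`
symmetrically. Both have exactly the common lower bounds as strict predecessors, so uniqueness of
limits provides a largest one. -/
theorem exists_isGreatest_lowerBounds (s t : T) : ∃ m, IsGLB {s, t} m := by
  by_cases hst : s ≤ t
  · exact ⟨s, by simp [hst], fun r hr => hr (by simp)⟩
  by_cases hts : t ≤ s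
  · exact ⟨t, by simp [hts], fun r hr => hr (by simp)⟩
  obtain ⟨a, has, ⟨-, hat⟩, ha⟩ :=
    exists_minimal_le (P := fun r => r ≤ s ∧ ¬ r ≤ t) (t := s) ⟨le_rfl, hst⟩
  obtain ⟨b, hbt, ⟨-, hbs⟩, hb⟩ :=
    exists_minimal_le (P := fun r => r ≤ t ∧ ¬ r ≤ s) (t := t) ⟨le_rfl, hts⟩
  have ha' : ∀ {r}, r < a ↔ r ≤ s ∧ r ≤ t := by
    intro r
    constructor
    · intro hr
      refine ⟨hr.le.trans has, by_contra fun h => ?_⟩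
      exact hr.not_ge (ha ⟨hr.le.trans has, h⟩ hr.le)
    · rintro ⟨h1, h2⟩
      rcases le_or_le h1 has with h | h
      · exact h.lt_of_ne fun h => hat (h ▸ h2)
      · exact absurd (h.trans h2) hat
  have hb' : ∀ {r}, r < b ↔ r ≤ s ∧ r ≤ t := by
    intro r
    constructor
    · intro hr
      refine ⟨by_contra fun h => ?_, hr.le.trans hbt⟩
      exact hr.not_ge (hb ⟨hr.le.trans hbt, h⟩ hr.le)
    · rintro ⟨h1, h2⟩
      rcases le_or_le h2 hbt with h | h
      · exact h.lt_of_ne fun h => hbs (h ▸ h1)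
      · exact absurd (h.trans h1) hbs
  obtain ⟨m, hm, hmax⟩ := exists_isGreatest (a := a) (b := b)
    (Set.ext fun r => by simp only [Set.mem_Iio, ha', hb']) fun h => hat (h ▸ hbt)
  have hm' := ha'.1 hm
  refine ⟨m, by simp [hm'.1, hm'.2], fun r hr => hmax (ha'.2 ⟨hr (by simp), hr (by simp)⟩)⟩

/-- The meet of two nodes. -/
noncomputable def meet (s t : T) : T := (exists_isGreatest_lowerBounds s t).choose

theorem le_meet_iff {r s t : T} : r ≤ meet s t ↔ r ≤ s ∧ r ≤ t := by
  refine (le_isGLB_iff (exists_isGreatest_lowerBounds s t).choose_spec).trans ?_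
  simp [lowerBounds]

theorem meet_le_left (s t : T) : meet s t ≤ s := (le_meet_iff.1 le_rfl).1

theorem meet_le_right (s t : T) : meet s t ≤ t := (le_meet_iff.1 le_rfl).2

/-- The real labels used to separate the immediate successors of a node. -/
noncomputable def label : T → ℝ := (exists_label (T := T)).choose

theorem label_injective : Function.Injective (label : T → ℝ) := exists_label.choose_spec.1

theorem label_mem (t : T) : label t ∈ Set.Icc (0 : ℝ) 1 := exists_label.choose_spec.2 t

open Classical in
/-- The label of the immediate successor of `s` below `t`, or `0` if there is none. -/
noncomputable def exit (s t : T) : ℝ :=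
  if h : ∃ r, Minimal (fun r => s < r ∧ r ≤ t) r then label h.choose else 0

theorem exit_mem (s t : T) : exit s t ∈ Set.Icc (0 : ℝ) 1 := by
  unfold exit
  split_ifs
  · exact label_mem _
  · simp

theorem exit_self (s : T) : exit s s = 0 :=
  dif_neg fun ⟨_, h, _⟩ => h.1.not_ge h.2

theorem minimal_unique {s t a b : T} (ha : Minimal (fun r => s < r ∧ r ≤ t) a)
    (hb : Minimal (fun r => s < r ∧ r ≤ t) b) : a = b := by
  rcases le_or_le ha.1.2 hb.1.2 with h | h
  · exact h.antisymm (hb.2 ha.1 h)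
  · exact (ha.2 hb.1 h).antisymm h

theorem exists_child {s t : T} (h : s < t) :
    ∃ c, Minimal (fun r => s < r ∧ r ≤ t) c ∧ exit s t = label c := by
  obtain ⟨m, -, hm⟩ := exists_minimal_le (P := fun r => s < r ∧ r ≤ t) (t := t) ⟨h, le_rfl⟩
  have he : ∃ r, Minimal (fun r => s < r ∧ r ≤ t) r := ⟨m, hm⟩
  exact ⟨he.choose, he.choose_spec, dif_pos he⟩

theorem exit_congr {r s t : T} (h : r < s) (hst : s ≤ t) : exit r s = exit r t := by
  obtain ⟨c, hc, h1⟩ := exists_child h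
  obtain ⟨d, hd, h2⟩ := exists_child (h.trans_le hst)
  rw [h1, h2]
  congr 1
  refine minimal_unique (s := r) (t := t) ⟨⟨hc.1.1, hc.1.2.trans hst⟩, fun e he hec => ?_⟩ hd
  exact hc.2 ⟨he.1, hec.trans hc.1.2⟩ hec

/-- Equal labels would mean a common immediate successor, hence a common lower bound above the meet.
-/
theorem exit_meet_ne {s t : T} (hs : meet s t < s) (ht : meet s t < t) :
    exit (meet s t) s ≠ exit (meet s t) t := by
  obtain ⟨c, hc, h1⟩ := exists_child hs
  obtain ⟨d, hd, h2⟩ := exists_child ht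
  rw [h1, h2]
  intro h
  obtain rfl := label_injective h
  exact hc.1.1.not_ge (le_meet_iff.2 ⟨hc.1.2, hd.1.2⟩)

theorem countable_ht_eq (γ : CountableOrdinal) : {t : T | ht t = γ}.Countable := by
  refine countable_of_isAntichain _ fun a ha b hb hab h => ?_
  exact (ht_strictMono (h.lt_of_ne hab)).ne (ha.trans hb.symm)

theorem countable_ht_le (γ : CountableOrdinal) : {t : T | ht t ≤ γ}.Countable := by
  have h : {t : T | ht t ≤ γ} = ⋃ δ ∈ Set.Iio γ.next, {t : T | ht t = δ} := by
    ext t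
    simp only [Set.mem_ofPred_eq, Set.mem_iUnion, Set.mem_Iio, CountableOrdinal.lt_next_iff,
      exists_prop, exists_eq_right']
  rw [h]
  exact (CountableOrdinal.countable_Iio _).biUnion fun δ _ => countable_ht_eq δ

theorem exists_lt_ht {A : Set T} (hA : ¬ A.Countable) (γ : CountableOrdinal) :
    ∃ t ∈ A, γ < ht t := by
  by_contra! h
  exact hA ((countable_ht_le γ).mono h)

/-- Above an uncountable set there is a node below which the set is cofinal. -/
theorem exists_node_cofinal {A : Set T} (hA : ¬ A.Countable) :
    ∃ (b : T) (m : ℕ → T), (∀ n, m n ∈ A ∧ m n < b) ∧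
      ∀ γ < ht b, ∃ N, ∀ n ≥ N, γ < ht (m n) := by
  have hstep : ∀ γ : CountableOrdinal, ∃ δ, ∀ m, Minimal (fun t => t ∈ A ∧ γ < ht t) m → ht m < δ := by
    intro γ
    have := (countable_of_isAntichain _
      (setOfPred_minimal_antichain fun t : T => t ∈ A ∧ γ < ht t)).to_subtype
    obtain ⟨δ, hδ⟩ := CountableOrdinal.exists_forall_lt_of_countable
      fun m : {t | Minimal (fun t : T => t ∈ A ∧ γ < ht t) t} => ht m.1
    exact ⟨δ, fun m hm => hδ ⟨m, hm⟩⟩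
  choose F hF using hstep
  -- Minimal elements of `A` above height `α n` form a countable antichain, so all have height below
  -- `α (n + 1)`. Let `lam` be the supremum of the `α n`: below a node of `A` higher than `lam`,
  -- these minimal elements lie under its predecessor `b` of height `lam`.
  let α : ℕ → CountableOrdinal := fun n => (fun γ => max (F γ) γ.next)^[n] CountableOrdinal.zero
  have hα : ∀ n, α (n + 1) = max (F (α n)) (α n).next := fun n =>
    Function.iterate_succ_apply' _ _ _
  have hmono : StrictMono α := strictMono_nat_of_lt_succ fun n => by
    rw [hα]
    exact (CountableOrdinal.lt_next _).trans_le (le_max_right _ _)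
  obtain ⟨lam, hlam, hmin⟩ := WellFounded.has_min (wellFounded_lt (α := CountableOrdinal))
    {γ | ∀ n, α n < γ} (CountableOrdinal.exists_forall_lt_of_countable α)
  obtain ⟨a, haA, ha⟩ := exists_lt_ht hA lam
  obtain ⟨b, hba, hb⟩ := exists_le_ht_eq ha.le
  have hm : ∀ n, ∃ m, (m ∈ A ∧ m < b) ∧ α n < ht m := by
    intro n
    obtain ⟨m, hma, hm⟩ := exists_minimal_le (P := fun t => t ∈ A ∧ α n < ht t) (t := a)
      ⟨haA, (hlam n).trans ha⟩
    refine ⟨m, ⟨hm.1.1, lt_of_ht_lt hma hba ?_⟩, hm.1.2⟩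
    rw [hb]
    refine (hF (α n) m hm).trans_le (le_trans ?_ (hlam (n + 1)).le)
    rw [hα]
    exact le_max_left _ _
  choose m hm1 hm2 using hm
  refine ⟨b, m, hm1, fun γ hγ => ?_⟩
  have : ¬ ∀ n, α n < γ := fun h => hmin γ h (hb ▸ hγ)
  push Not at this
  obtain ⟨N, hN⟩ := this
  exact ⟨N, fun n hn => (hN.trans (hmono.monotone hn)).trans_lt (hm2 n)⟩

/-- An uncountable set of nodes is uncountable above each of two incomparable nodes. -/
theorem exists_incomparable {A : Set T} (hA : ¬ A.Countable) :
    ∃ q₀ q₁ : T, ¬ q₀ ≤ q₁ ∧ ¬ q₁ ≤ q₀ ∧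
      ¬ (A ∩ Set.Ici q₀).Countable ∧ ¬ (A ∩ Set.Ici q₁).Countable := by
  by_contra! hc
  refine hA ?_
  -- If the claim fails, the `Q`-nodes form a chain and the minimal non-`Q`-nodes an antichain. Both
  -- are countable, and every element of `A` is in the former or above one of the latter.
  let Q : T → Prop := fun t => ¬ (A ∩ Set.Ici t).Countable
  have h1 : {t | Q t}.Countable := by
    refine countable_of_isChain _ fun a ha b hb _ => ?_
    by_contra! h
    exact hb (hc a b h.1 h.2 ha)
  have h2 : {m | Minimal (fun t => ¬ Q t) m}.Countable :=
    countable_of_isAntichain _ (setOfPred_minimal_antichain _)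
  refine (h1.union (h2.biUnion (t := fun m _ => A ∩ Set.Ici m)
    fun m hm => not_not.1 hm.1)).mono fun a ha => ?_
  by_cases hQ : Q a
  · exact Or.inl hQ
  · obtain ⟨m, hma, hm⟩ := exists_minimal_le (P := fun t => ¬ Q t) hQ
    exact Or.inr (Set.mem_biUnion hm ⟨ha, hma⟩)

end HausdorffSuslinTree

/-! ### The surface: charts, topology, Hausdorff and Type I properties. -/

open HausdorffSuslinTree in
/-- The surface associated with a tree: each node carries a half-open strip `[0, 1) × ℝ`, the bottom
line of the root being deleted. -/
@[ext]
structure TreeSurface (T : Type) [PartialOrder T] [HausdorffSuslinTree T] where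
  /-- The node of the tree. -/
  node : T
  /-- The height inside the strip of the node. -/
  pos : Set.Ico (0 : ℝ) 1
  /-- The horizontal coordinate inside the strip. -/
  fib : ℝ
  zero_lt : LongRay.base CountableOrdinal.zero < LongRay.mk (ht node) pos

namespace TreeSurface

open HausdorffSuslinTree LongRay Topology

variable {T : Type} [PartialOrder T] [HausdorffSuslinTree T]

/-- The height of a point, as a point of the long ray. -/
noncomputable def height (p : TreeSurface T) : LongRay := LongRay.mk (ht p.node) p.pos

@[simp] theorem level_height (p : TreeSurface T) : p.height.level = ht p.node := rfl

@[simp] theorem frac_height (p : TreeSurface T) : p.height.frac = p.pos := rfl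

/-- An increasing homeomorphism from `[0, 1)` to `[0, ∞)`. -/
noncomputable def slope (y : ℝ) : ℝ := y / (1 - y)

theorem continuousOn_slope : ContinuousOn slope (Set.Iio 1) :=
  continuousOn_id.div (continuousOn_const.sub continuousOn_id)
    fun _ h => (sub_pos.2 h).ne'

theorem slope_zero : slope 0 = 0 := zero_div _

theorem slope_nonneg (y : Set.Ico (0 : ℝ) 1) : 0 ≤ slope y :=
  div_nonneg y.2.1 (sub_nonneg.2 y.2.2.le)

/-- The horizontal coordinate in the chart of the node `t`. -/
noncomputable def coord (t : T) (p : TreeSurface T) : ℝ := p.fib + exit p.node t * slope p.pos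

/-- The chart of the node `t`. It is meaningful on the points whose node lies below `t`. -/
noncomputable def chart (t : T) (p : TreeSurface T) : LongRay × ℝ := (p.height, coord t p)

theorem exit_eq_of_le_meet {r s t : T} (h : r < meet s t) : exit r s = exit r t := by
  rw [← exit_congr h (meet_le_left s t), exit_congr h (meet_le_right s t)]

/-- The horizontal shift between the charts of `s` and `t`. -/
noncomputable def shift (s t : T) (q : LongRay) : ℝ :=
  (exit (meet s t) t - exit (meet s t) s) * slope (clamp (ht (meet s t)) q)

/-- Strictly below the meet both shears use the same label, and there `clamp` makes the shift
vanish; only the strip of the meet itself is moved. -/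
theorem coord_eq_add_shift {s t : T} {p : TreeSurface T} (hs : p.node ≤ s) (ht : p.node ≤ t) :
    coord t p = coord s p + shift s t p.height := by
  unfold coord shift
  rcases (le_meet_iff.2 ⟨hs, ht⟩).lt_or_eq with h | h
  · rw [clamp_of_lt (by exact ht_strictMono h), slope_zero, exit_eq_of_le_meet h]
    ring
  · rw [← h, clamp_of_eq (level_height p), frac_height]
    ring

theorem continuousOn_shift (s t : T) :
    ContinuousOn (shift s t) (Set.Iio (base (ht (meet s t)).next)) :=
  continuousOn_const.mul (continuousOn_slope.comp (continuous_clamp _).continuousOn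
    fun _ hq => clamp_lt_one (CountableOrdinal.lt_next_iff.1 (lt_base_iff.1 hq)))

theorem height_lt_next_iff {s t : T} {p : TreeSurface T} (hs : p.node ≤ s) (hts : t ≤ s) :
    p.height < base (ht t).next ↔ p.node ≤ t := by
  rw [lt_base_iff, level_height, CountableOrdinal.lt_next_iff]
  exact ⟨le_of_ht_le hs hts, fun h => ht_strictMono.monotone h⟩

/-- Openness is tested in every chart; that chart domains are themselves open is a consequence of
the transition maps being continuous (`isOpen_setOf_chart_mem`). -/
instance : TopologicalSpace (TreeSurface T) where
  IsOpen O := ∀ t, ∃ W, IsOpen W ∧ ∀ p, p.node ≤ t → (p ∈ O ↔ chart t p ∈ W)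
  isOpen_univ t := ⟨Set.univ, isOpen_univ, by simp⟩
  isOpen_inter O O' h h' t := by
    obtain ⟨W, hW, h⟩ := h t
    obtain ⟨W', hW', h'⟩ := h' t
    exact ⟨W ∩ W', hW.inter hW', fun p hp => and_congr (h p hp) (h' p hp)⟩
  isOpen_sUnion S h t := by
    choose! W hW h using fun O hO => h O hO t
    refine ⟨⋃ O ∈ S, W O, isOpen_biUnion hW, fun p hp => ?_⟩
    simp only [Set.mem_sUnion, Set.mem_iUnion, exists_prop]
    exact exists_congr fun O => and_congr_right fun hO => h O hO p hp

theorem isOpen_iff {O : Set (TreeSurface T)} :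
    IsOpen O ↔ ∀ t, ∃ W, IsOpen W ∧ ∀ p, p.node ≤ t → (p ∈ O ↔ chart t p ∈ W) := Iff.rfl

theorem continuous_of_chart {Y : Type*} [TopologicalSpace Y] {f : TreeSurface T → Y}
    (h : ∀ t, ∃ g : LongRay × ℝ → Y, Continuous g ∧ ∀ p, p.node ≤ t → f p = g (chart t p)) :
    Continuous f := by
  refine ⟨fun V hV => isOpen_iff.2 fun t => ?_⟩
  obtain ⟨g, hg, h⟩ := h t
  exact ⟨g ⁻¹' V, hV.preimage hg, fun p hp => by rw [Set.mem_preimage, h p hp]; rfl⟩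

theorem continuous_height : Continuous (height : TreeSurface T → LongRay) :=
  continuous_of_chart fun _ => ⟨Prod.fst, continuous_fst, fun _ _ => rfl⟩

/-- In the chart of `s`, the overlap with the chart of `t` is the part below the top of the strip of
`meet s t`, an open condition on height; there the transition map is a continuous shear. -/
theorem isOpen_setOf_chart_mem (t : T) {W : Set (LongRay × ℝ)} (hW : IsOpen W) :
    IsOpen {p : TreeSurface T | p.node ≤ t ∧ chart t p ∈ W} := by
  refine isOpen_iff.2 fun s => ?_
  let D : Set (LongRay × ℝ) := Set.Iio (base (ht (meet s t)).next) ×ˢ Set.univ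
  have hD : IsOpen D := isOpen_Iio.prod isOpen_univ
  have hcont : ContinuousOn (fun z : LongRay × ℝ => (z.1, z.2 + shift s t z.1)) D :=
    continuousOn_fst.prodMk (continuousOn_snd.add
      ((continuousOn_shift s t).comp continuousOn_fst fun z hz => hz.1))
  refine ⟨_, hcont.isOpen_inter_preimage hD hW, fun p hp => ?_⟩
  have hmem : chart s p ∈ D ↔ p.node ≤ t := by
    rw [show chart s p ∈ D ↔ p.height < base (ht (meet s t)).next by simp [D, chart],
      height_lt_next_iff hp (meet_le_left s t), le_meet_iff]
    exact and_iff_right hp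
  rw [Set.mem_inter_iff, hmem]
  refine and_congr_right fun hpt => ?_
  rw [Set.mem_preimage, chart, coord_eq_add_shift hp hpt]
  rfl

theorem isOpen_setOf_node_le (t : T) : IsOpen {p : TreeSurface T | p.node ≤ t} := by
  simpa using isOpen_setOf_chart_mem t isOpen_univ

theorem range_chart (t : T) :
    Set.range (fun p : {p : TreeSurface T | p.node ≤ t} => chart t p.1) =
      Set.Ioo (base CountableOrdinal.zero) (base (ht t).next) ×ˢ Set.univ := by
  ext ⟨q, x⟩
  constructor
  · rintro ⟨⟨p, hp⟩, h⟩
    obtain ⟨rfl, rfl⟩ := Prod.ext_iff.1 h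
    exact ⟨⟨p.zero_lt, (height_lt_next_iff hp le_rfl).2 hp⟩, trivial⟩
  · rintro ⟨⟨h0, h1⟩, -⟩
    obtain ⟨s, hst, hs⟩ := exists_le_ht_eq (CountableOrdinal.lt_next_iff.1 (lt_base_iff.1 h1))
    have hq : LongRay.mk (ht s) q.frac = q := by rw [hs, mk_level_frac]
    refine ⟨⟨⟨s, q.frac, x - exit s t * slope q.frac, by rwa [hq]⟩, hst⟩, ?_⟩
    exact Prod.ext hq (by simp [chart, coord])

theorem isOpenEmbedding_chart (t : T) :
    IsOpenEmbedding fun p : {p : TreeSurface T | p.node ≤ t} => chart t p.1 := by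
  refine ⟨⟨⟨?_⟩, ?_⟩, ?_⟩
  · ext O
    rw [isOpen_induced_iff, isOpen_induced_iff]
    constructor
    · rintro ⟨O', hO', rfl⟩
      obtain ⟨W, hW, h⟩ := hO' t
      exact ⟨W, hW, Set.ext fun p => (h p.1 p.2).symm⟩
    · rintro ⟨W, hW, rfl⟩
      exact ⟨_, isOpen_setOf_chart_mem t hW, Set.ext fun p => and_iff_right p.2⟩
  · rintro ⟨p, hp⟩ ⟨q, hq⟩ h
    obtain ⟨h1, h2⟩ := Prod.ext_iff.1 h
    have hn : p.node = q.node := by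
      have : ht p.node = ht q.node := congrArg level h1
      exact (le_of_ht_le hp hq this.le).antisymm (le_of_ht_le hq hp this.ge)
    have hpos : p.pos = q.pos := congrArg frac h1
    refine Subtype.ext (TreeSurface.ext hn hpos ?_)
    simpa [chart, coord, hn, hpos] using h2
  · rw [range_chart]
    exact isOpen_Ioo.prod isOpen_univ

/-- Each chart domain is a plane. -/
theorem nonempty_homeomorph_plane (t : T) :
    Nonempty ({p : TreeSurface T | p.node ≤ t} ≃ₜ ℝ × ℝ) := by
  obtain ⟨e⟩ := nonempty_homeomorph_Ioo (β := (ht t).next)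
    ((CountableOrdinal.zero_le _).trans_lt (ht t).lt_next)
  exact ⟨(isOpenEmbedding_chart t).isEmbedding.toHomeomorph.trans
    ((Homeomorph.setCongr (range_chart t)).trans ((Homeomorph.Set.prod _ _).trans
      (e.prodCongr (Homeomorph.Set.univ ℝ))))⟩

theorem isLindelof_setOf_node_le (t : T) : IsLindelof {p : TreeSurface T | p.node ≤ t} := by
  obtain ⟨e⟩ := nonempty_homeomorph_plane t
  rw [isLindelof_iff_lindelofSpace]
  have := e.secondCountableTopology
  infer_instance

theorem isLindelof_setOf_height_le (γ : CountableOrdinal) :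
    IsLindelof {p : TreeSurface T | p.height ≤ base γ} := by
  have h1 : IsLindelof (⋃ t ∈ {t : T | ht t ≤ γ}, {p : TreeSurface T | p.node ≤ t}) :=
    (countable_ht_le γ).isLindelof_biUnion fun t _ => isLindelof_setOf_node_le t
  refine h1.of_isClosed_subset (isClosed_Iic.preimage continuous_height) fun p hp => ?_
  refine Set.mem_biUnion (x := p.node) ?_ (le_refl p.node)
  rcases le_iff.1 hp with h | h
  · exact h.le
  · exact h.1.le

theorem exists_height_lt_of_isLindelof {K : Set (TreeSurface T)} (hK : IsLindelof K) :
    ∃ γ, ∀ p ∈ K, p.height < base γ := by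
  obtain ⟨r, hr, hKr⟩ := hK.elim_countable_subcover (fun γ => height ⁻¹' Set.Iio (base γ))
    (fun γ => isOpen_Iio.preimage continuous_height) fun p _ =>
      Set.mem_iUnion.2 ⟨(ht p.node).next, lt_base_iff.2 (CountableOrdinal.lt_next _)⟩
  have := hr.to_subtype
  obtain ⟨β, hβ⟩ := CountableOrdinal.exists_forall_lt_of_countable fun γ : r => γ.1
  refine ⟨β, fun p hp => ?_⟩
  obtain ⟨γ, hγ, h⟩ := Set.mem_iUnion₂.1 (hKr hp)
  exact lt_trans (b := base γ) h (base_lt_base.2 (hβ ⟨γ, hγ⟩))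

theorem t2Space : T2Space (TreeSurface T) := by
  refine ⟨fun p q hpq => ?_⟩
  by_cases hs : ∃ t, p.node ≤ t ∧ q.node ≤ t
  · obtain ⟨t, hp, hq⟩ := hs
    have hne : chart t p ≠ chart t q := fun h => hpq
      (congrArg Subtype.val ((isOpenEmbedding_chart t).injective
        (a₁ := ⟨p, hp⟩) (a₂ := ⟨q, hq⟩) h))
    obtain ⟨V, W, hV, hW, hpV, hqW, hVW⟩ := t2_separation hne
    exact ⟨_, _, isOpen_setOf_chart_mem t hV, isOpen_setOf_chart_mem t hW, ⟨hp, hpV⟩, ⟨hq, hqW⟩,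
      Set.disjoint_left.2 fun r hr hr' => Set.disjoint_left.1 hVW hr.2 hr'.2⟩
  · push Not at hs
    have hms : meet p.node q.node < p.node := (meet_le_left _ _).lt_of_ne fun h =>
      hs q.node (h ▸ meet_le_right _ _) le_rfl
    have hmt : meet p.node q.node < q.node := (meet_le_right _ _).lt_of_ne fun h =>
      hs p.node le_rfl (by rw [← h]; exact meet_le_left _ _)
    have hc := abs_pos.2 (sub_ne_zero.2 (exit_meet_ne hms hmt).symm)
    set m := meet p.node q.node with hm
    set c := |exit m q.node - exit m p.node|
    set x := coord p.node p
    set x' := coord q.node q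
    -- In the strip of `m` the two coordinates differ by `c * slope`, and `y` below has slope `K`.
    -- Above it they differ by more than `|x' - x| + 2`, which unit balls around `x` and `x'` do not
    -- allow.
    obtain ⟨K, hK0, hK⟩ : ∃ K : ℝ, 0 ≤ K ∧ |x' - x| + 2 ≤ c * K :=
      ⟨(|x' - x| + 2) / c, by positivity, by rw [mul_div_cancel₀ _ hc.ne']⟩
    let y : Set.Ico (0 : ℝ) 1 :=
      ⟨K / (1 + K), by positivity, (div_lt_one (by positivity)).2 (by linarith)⟩
    have hy : ∀ r : TreeSurface T, r.node ≤ p.node → r.node ≤ q.node → LongRay.mk (ht m) y < r.height →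
        |x' - x| + 2 < |coord q.node r - coord p.node r| := by
      intro r hrp hrq hr
      have hrm : r.node ≤ m := le_meet_iff.2 ⟨hrp, hrq⟩
      rcases lt_iff.1 hr with h | ⟨h, h'⟩
      · exact absurd (ht_strictMono.monotone hrm) h.not_ge
      · have hslope : K < slope r.pos := by
          have h1 : K / (1 + K) < r.pos := h'
          rw [div_lt_iff₀ (by positivity)] at h1
          rw [slope, lt_div_iff₀ (sub_pos.2 r.pos.2.2)]
          linarith
        rw [coord_eq_add_shift hrp hrq, add_sub_cancel_left, shift, ← hm,
          clamp_of_eq (α := ht m) (q := r.height) h.symm, frac_height, abs_mul,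
          abs_of_pos (hK0.trans_lt hslope)]
        exact hK.trans_lt (mul_lt_mul_of_pos_left hslope hc)
    have hlt : ∀ r : TreeSurface T, m < r.node → LongRay.mk (ht m) y < r.height := fun r hr =>
      lt_iff.2 (Or.inl (ht_strictMono hr))
    refine ⟨_, _, isOpen_setOf_chart_mem p.node (isOpen_Ioi.prod (Metric.isOpen_ball (x := x) (ε := 1))),
      isOpen_setOf_chart_mem q.node (isOpen_Ioi.prod (Metric.isOpen_ball (x := x') (ε := 1))),
      ⟨le_rfl, hlt p hms, Metric.mem_ball_self one_pos⟩,
      ⟨le_rfl, hlt q hmt, Metric.mem_ball_self one_pos⟩, ?_⟩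
    refine Set.disjoint_left.2 fun r hr hr' => ?_
    have h1 := hy r hr.1 hr'.1 hr.2.1
    have h2 : |coord p.node r - x| < 1 := hr.2.2
    have h3 : |coord q.node r - x'| < 1 := hr'.2.2
    have h4 : coord q.node r - coord p.node r =
      (coord q.node r - x') + (x' - x) - (coord p.node r - x) := by ring
    rw [h4] at h1
    have h5 := abs_sub (coord q.node r - x' + (x' - x)) (coord p.node r - x)
    have h6 := abs_add_le (coord q.node r - x') (x' - x)
    linarith

theorem exists_root : ∃ r : T, ∀ t, r ≤ t := by
  have := HausdorffSuslinTree.uncountable (T := T)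
  obtain ⟨t₀⟩ : Nonempty T := inferInstance
  obtain ⟨r, -, hr⟩ := exists_minimal_le (P := fun _ : T => True) (t := t₀) trivial
  refine ⟨r, fun t => ?_⟩
  exact (hr.2 trivial (meet_le_left r t)).trans (meet_le_right r t)

theorem connectedSpace : ConnectedSpace (TreeSurface T) := by
  obtain ⟨r, hr⟩ := exists_root (T := T)
  let p₀ : TreeSurface T := ⟨r, ⟨1 / 2, by norm_num, by norm_num⟩, 0, by
    rw [lt_iff]
    rcases (CountableOrdinal.zero_le (ht r)).lt_or_eq with h | h
    · exact Or.inl h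
    · exact Or.inr ⟨h, by norm_num⟩⟩
  have hpre : IsPreconnected (Set.univ : Set (TreeSurface T)) := by
    -- Every chart domain is a plane containing the point `p₀` over the root.
    refine isPreconnected_of_forall p₀ fun p _ =>
      ⟨{q | q.node ≤ p.node}, Set.subset_univ _, hr _, le_refl p.node, ?_⟩
    obtain ⟨e⟩ := nonempty_homeomorph_plane p.node
    rw [isPreconnected_iff_preconnectedSpace]
    exact ⟨by rw [← e.symm.surjective.range_eq]; exact isPreconnected_range e.symm.continuous⟩
  exact { isPreconnected_univ := hpre, toNonempty := ⟨p₀⟩ }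

theorem isSurface : IsSurface (TreeSurface T) where
  t2Space := t2Space
  connectedSpace := connectedSpace
  locally_plane p := by
    obtain ⟨e⟩ := nonempty_homeomorph_plane p.node
    exact ⟨_, isOpen_setOf_node_le p.node, le_refl p.node,
      ⟨e.trans (Homeomorph.finTwoArrow.symm.trans
        (EuclideanSpace.equiv (Fin 2) ℝ).symm.toHomeomorph)⟩⟩

theorem not_lindelofSpace : ¬ LindelofSpace (TreeSurface T) := by
  intro h
  obtain ⟨γ, hγ⟩ := exists_height_lt_of_isLindelof (T := T) isLindelof_univ
  have := HausdorffSuslinTree.uncountable (T := T)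
  obtain ⟨t, -, ht'⟩ := exists_lt_ht (A := (Set.univ : Set T))
    (fun h => not_countable (Set.countable_univ_iff.1 h)) γ
  have := hγ ⟨t, ⟨0, by simp⟩, 0, base_lt_base.2 ((CountableOrdinal.zero_le γ).trans_lt ht')⟩ trivial
  exact (lt_base_iff.1 this).not_gt ht'

theorem isTypeISpace : IsTypeISpace (TreeSurface T) := by
  have hcl : ∀ γ, closure (height ⁻¹' Set.Iio (base γ)) ⊆ {p : TreeSurface T | p.height ≤ base γ} :=
    fun γ => closure_minimal (fun p (hp : p.height < base γ) => hp.le) (isClosed_Iic.preimage continuous_height)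
  exact ⟨fun γ => height ⁻¹' Set.Iio (base γ),
    fun γ => isOpen_Iio.preimage continuous_height,
    fun γ => (isLindelof_setOf_height_le γ).of_isClosed_subset isClosed_closure (hcl γ),
    fun α β h p hp => (hcl α hp).trans_lt (base_lt_base.2 h),
    Set.eq_univ_of_forall fun p =>
      Set.mem_iUnion.2 ⟨(ht p.node).next, lt_base_iff.2 (CountableOrdinal.lt_next _)⟩,
    not_lindelofSpace⟩

end TreeSurface

/-! ### Accumulation points, and the absence of directions. -/

namespace TreeSurface

open HausdorffSuslinTree LongRay Topology

variable {T : Type} [PartialOrder T] [HausdorffSuslinTree T]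

theorem abs_coord_le {n : ℕ} {p : TreeSurface T} (t : T) (h1 : |p.fib| ≤ n) (h2 : slope p.pos ≤ n) :
    |coord t p| ≤ 2 * n := by
  have h3 := exit_mem p.node t
  have h4 : |exit p.node t * slope p.pos| ≤ n := by
    rw [abs_of_nonneg (mul_nonneg h3.1 (slope_nonneg _))]
    exact (mul_le_of_le_one_left (slope_nonneg _) h3.2).trans h2
  have := abs_add_le p.fib (exit p.node t * slope p.pos)
  unfold coord
  linarith

/-- A set meeting uncountably many strips has an accumulation point. -/
theorem exists_accPt {E : Set (TreeSurface T)} (hE : ¬ (node '' E).Countable) :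
    ∃ p, AccPt p (Filter.principal E) := by
  have hbound : ∃ n : ℕ, ¬ (node '' {p ∈ E | |p.fib| ≤ n ∧ slope p.pos ≤ n}).Countable := by
    by_contra! h
    refine hE ((Set.countable_iUnion h).mono ?_)
    rintro _ ⟨p, hp, rfl⟩
    obtain ⟨n, hn⟩ := exists_nat_ge (max |p.fib| (slope p.pos))
    exact Set.mem_iUnion.2 ⟨n, p, ⟨hp, (le_max_left _ _).trans hn, (le_max_right _ _).trans hn⟩, rfl⟩
  obtain ⟨n, hn⟩ := hbound
  obtain ⟨b, m, hm, hcof⟩ := exists_node_cofinal hn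
  choose p hp hpm using fun k => (hm k).1
  have hlt : ∀ k, (p k).node < b := fun k => (hpm k).symm ▸ (hm k).2
  obtain ⟨x, -, φ, hφ, hx⟩ := isCompact_Icc.tendsto_subseq (x := fun k => coord b (p k))
    (s := Set.Icc (-(2 * n : ℝ)) (2 * n)) fun k => abs_le.1 (abs_coord_le b (hp k).2.1 (hp k).2.2)
  have hheight : Filter.Tendsto (fun k => (p k).height) Filter.atTop (𝓝 (base (ht b))) := by
    refine tendsto_order.2 ⟨fun q hq => ?_, fun q hq => Filter.Eventually.of_forall fun k => ?_⟩
    · obtain ⟨N, hN⟩ := hcof _ (lt_base_iff.1 hq)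
      refine Filter.eventually_atTop.2 ⟨N, fun k hk => lt_iff.2 (Or.inl ?_)⟩
      rw [level_height, hpm]
      exact hN k hk
    · exact (lt_base_iff.2 (ht_strictMono (hlt k))).trans hq
  -- The limit lies on the bottom line of the strip of `b`, whereas the sequence stays in strictly
  -- lower strips and so never equals it.
  refine ⟨⟨b, ⟨0, by simp⟩, x, ?_⟩, accPt_iff_nhds.2 fun O hO => ?_⟩
  · exact base_lt_base.2 ((CountableOrdinal.zero_le _).trans_lt (ht_strictMono (hlt 0)))
  obtain ⟨O', hO', hopen, hmem⟩ := mem_nhds_iff.1 hO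
  obtain ⟨W, hW, h⟩ := isOpen_iff.1 hopen b
  have hxW := (h _ le_rfl).1 hmem
  simp only [chart, coord, exit_self, zero_mul, add_zero] at hxW
  have htend : Filter.Tendsto (fun k => chart b (p (φ k))) Filter.atTop (𝓝 (base (ht b), x)) :=
    (hheight.comp hφ.tendsto_atTop).prodMk_nhds hx
  obtain ⟨k, hk⟩ := (htend.eventually (hW.mem_nhds hxW)).exists
  refine ⟨p (φ k), ⟨hO' ((h _ (hlt _).le).2 hk), (hp _).1⟩, fun heq => ?_⟩
  exact (hlt (φ k)).ne (congrArg node heq)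

theorem isOmegaOneCompact : IsOmegaOneCompact (TreeSurface T) := by
  intro E hE hdisc
  have hnodes : (node '' E).Countable := by
    by_contra h
    obtain ⟨p, hp⟩ := exists_accPt h
    have := isClosed_and_discrete_iff.1 ⟨hE, ⟨hdisc⟩⟩ p
    exact hp.ne this.eq_bot
  have hcover : E ⊆ ⋃ t ∈ node '' E, E ∩ {p | p.node ≤ t} := fun p hp =>
    Set.mem_biUnion (Set.mem_image_of_mem node hp) ⟨hp, le_refl p.node⟩
  refine (hnodes.biUnion fun t _ => ?_).mono hcover
  obtain ⟨e⟩ := nonempty_homeomorph_plane t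
  have := e.secondCountableTopology
  have hd : DiscreteTopology (Subtype.val ⁻¹' E : Set {p : TreeSurface T | p.node ≤ t}) :=
    DiscreteTopology.of_continuous_injective
      (f := fun p : (Subtype.val ⁻¹' E : Set {p : TreeSurface T | p.node ≤ t}) =>
        (⟨p.1.1, p.2⟩ : E)) (by fun_prop)
      fun p q h => Subtype.ext (Subtype.ext (congrArg (fun x : E => x.1) h))
  have hc : (Subtype.val ⁻¹' E : Set {p : TreeSurface T | p.node ≤ t}).Countable :=
    Set.countable_coe_iff.1 (TopologicalSpace.separableSpace_iff_countable.1 inferInstance)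
  refine (hc.image Subtype.val).mono ?_
  rintro p ⟨hp, hpt⟩
  exact ⟨⟨p, hpt⟩, hp, rfl⟩

open Classical in
/-- The height above level `ht q + 1` inside the cone of `q`, constant elsewhere. -/
noncomputable def coneHeight (q : T) (p : TreeSurface T) : LongRay :=
  if q ≤ p.node then max p.height (base (ht q).next) else base (ht q).next

/-- The cutoff is the top of the strip of `q`: in a chart of some `t ≥ q`, points outside the cone
lie below it, so the maximum with the cutoff describes both cases. Other charts miss the cone. -/
theorem continuous_coneHeight (q : T) : Continuous (coneHeight q : TreeSurface T → LongRay) := by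
  refine continuous_of_chart fun t => ?_
  by_cases hq : q ≤ t
  · refine ⟨fun z => max z.1 (base (ht q).next), by fun_prop, fun p hp => ?_⟩
    unfold coneHeight
    split_ifs with h
    · rfl
    · refine (max_eq_right (le_of_lt ?_)).symm
      refine (height_lt_next_iff hp hq).2 ?_
      exact (le_or_le hp hq).resolve_right h
  · exact ⟨fun _ => base (ht q).next, continuous_const, fun p hp => if_neg fun h => hq (h.trans hp)⟩

theorem isOpen_comparable (q : T) : IsOpen {p : TreeSurface T | p.node ≤ q ∨ q ≤ p.node} := by
  have h : {p : TreeSurface T | p.node ≤ q ∨ q ≤ p.node} =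
      ⋃ t ∈ Set.Ici q, {p : TreeSurface T | p.node ≤ t} := by
    ext p
    simp only [Set.mem_ofPred_eq, Set.mem_iUnion, Set.mem_Ici, exists_prop]
    constructor
    · rintro (h | h)
      · exact ⟨q, le_rfl, h⟩
      · exact ⟨_, h, le_rfl⟩
    · rintro ⟨t, hq, hp⟩
      exact le_or_le hp hq
  rw [h]
  exact isOpen_biUnion fun t _ => isOpen_setOf_node_le t

section TypeISequence

variable {U : CountableOrdinal → Set (TreeSurface T)}

theorem countable_node_image_of_isBoundedIn (hU : IsTypeISequence U) {A : Set (TreeSurface T)}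
    (hA : IsBoundedIn U A) : (node '' A).Countable := by
  obtain ⟨α, hα⟩ := hA
  obtain ⟨γ, hγ⟩ := exists_height_lt_of_isLindelof (hU.isLindelof_closure α)
  refine (countable_ht_le γ).mono ?_
  rintro _ ⟨p, hp, rfl⟩
  exact (lt_base_iff.1 (hγ p (subset_closure (hα hp)))).le

/-- Countably many chart domains form a Lindelöf set, which any Type I sequence swallows at a
countable stage. With the preceding lemma, boundedness becomes a property of nodes, independent of
`U`. -/
theorem isBoundedIn_of_countable_node_image (hU : IsTypeISequence U) {A : Set (TreeSurface T)}
    (hA : (node '' A).Countable) : IsBoundedIn U A := by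
  have hK : IsLindelof (⋃ t ∈ node '' A, {p : TreeSurface T | p.node ≤ t}) :=
    hA.isLindelof_biUnion fun t _ => isLindelof_setOf_node_le t
  obtain ⟨r, hr, hKr⟩ := hK.elim_countable_subcover U hU.isOpen
    (by rw [hU.iUnion_eq]; exact Set.subset_univ _)
  have := hr.to_subtype
  obtain ⟨β, hβ⟩ := CountableOrdinal.exists_forall_lt_of_countable fun γ : r => γ.1
  refine ⟨β, fun p hp => ?_⟩
  obtain ⟨γ, hγ, h⟩ := Set.mem_iUnion₂.1
    (hKr (Set.mem_biUnion (Set.mem_image_of_mem node hp) (le_refl p.node)))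
  exact hU.closure_subset γ β (hβ ⟨γ, hγ⟩) (subset_closure h)

theorem not_isDirection (hU : IsTypeISequence U) (D : Set (TreeSurface T)) :
    ¬ IsDirection U D := by
  rintro ⟨⟨hclosed, hunb⟩, hdir⟩
  obtain ⟨q₀, q₁, h01, h10, hA₀, hA₁⟩ := exists_incomparable
    (A := node '' D) fun h => hunb (isBoundedIn_of_countable_node_image hU h)
  -- Removing the whole comparable set, not just the cone above `q₀`, keeps `C` closed; `C` still
  -- contains all points of `D` above `q₁`.
  let C : Set (TreeSurface T) := D \ {p | p.node ≤ q₀ ∨ q₀ ≤ p.node}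
  have hC : IsClubIn U C := by
    refine ⟨hclosed.sdiff (isOpen_comparable q₀), fun h => hA₁ ?_⟩
    refine (countable_node_image_of_isBoundedIn hU h).mono ?_
    rintro _ ⟨⟨p, hp, rfl⟩, hpq⟩
    refine ⟨p, ⟨hp, ?_⟩, rfl⟩
    rintro (h | h)
    · exact h10 (le_trans hpq h)
    · exact (le_or_le h hpq).elim h01 h10
  refine (hdir C Set.sdiff_subset hC).2 (coneHeight q₀) (continuous_coneHeight q₀) ?_ ?_
  · rintro ⟨z, hz⟩
    obtain ⟨_, ⟨⟨p, hp, rfl⟩, hpq⟩, hlt⟩ := exists_lt_ht hA₀ z.level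
    have h1 : coneHeight q₀ p ≤ z := hz (Set.mem_image_of_mem _ hp)
    rw [coneHeight, if_pos (Set.mem_Ici.1 hpq)] at h1
    rcases le_iff.1 ((le_max_left _ _).trans h1) with h | h
    · exact h.not_gt hlt
    · exact hlt.ne h.1.symm
  · refine ⟨base (ht q₀).next, ?_⟩
    rintro _ ⟨p, hp, rfl⟩
    rw [coneHeight, if_neg fun h => hp.2 (Or.inr h)]

end TypeISequence

end TreeSurface

/-! ### From an arbitrary Suslin tree to one with a root and unique limits. -/

namespace IsTreeOrder

variable {T : Type} [PartialOrder T]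

theorem le_or_le (hT : IsTreeOrder T) {a b c : T} (ha : a ≤ c) (hb : b ≤ c) : a ≤ b ∨ b ≤ a := by
  rcases ha.lt_or_eq with ha | rfl
  · rcases hb.lt_or_eq with hb | rfl
    · have := hT c
      rcases trichotomous_of (· < ·) (⟨a, ha⟩ : Set.Iio c) ⟨b, hb⟩ with h | h | h
      · exact Or.inl (le_of_lt (show a < b from h))
      · exact Or.inl (congrArg Subtype.val h).le
      · exact Or.inr (le_of_lt (show b < a from h))
    · exact Or.inl ha.le
  · exact Or.inr hb

theorem wellFoundedLT (hT : IsTreeOrder T) : WellFoundedLT T := by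
  refine ⟨⟨fun x => Acc.intro x fun y hy => ?_⟩⟩
  have hacc : Acc (· < ·) (⟨y, hy⟩ : Set.Iio x) := (hT x).wf.apply _
  generalize hz : (⟨y, hy⟩ : Set.Iio x) = z at hacc
  obtain rfl : y = z.1 := congrArg Subtype.val hz
  clear hz hy
  induction hacc with
  | intro z _ ih => exact Acc.intro _ fun w hw => ih ⟨w, hw.trans z.2⟩ hw

end IsTreeOrder

/-- The tree of the initial segments `Set.Iio t` and `Set.Iic t` of a tree, ordered by inclusion.
Unlike the given tree, it has a single root and unique limits. -/
def SegmentTree (T : Type) [PartialOrder T] : Type :=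
  {A : Set T // ∃ t, A = Set.Iio t ∨ A = Set.Iic t}

namespace SegmentTree

variable {T : Type} [PartialOrder T]

instance : PartialOrder (SegmentTree T) :=
  inferInstanceAs (PartialOrder {A : Set T // ∃ t, A = Set.Iio t ∨ A = Set.Iic t})

theorem le_iff {A B : SegmentTree T} : A ≤ B ↔ A.1 ⊆ B.1 := Iff.rfl

theorem lt_iff {A B : SegmentTree T} : A < B ↔ A.1 ⊂ B.1 := Iff.rfl

/-- The segment `Set.Iio t`. -/
def iio (t : T) : SegmentTree T := ⟨Set.Iio t, t, Or.inl rfl⟩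

/-- The segment `Set.Iic t`. -/
def iic (t : T) : SegmentTree T := ⟨Set.Iic t, t, Or.inr rfl⟩

theorem eq_iio_or_eq_iic (A : SegmentTree T) : ∃ t, A = iio t ∨ A = iic t := by
  obtain ⟨t, h⟩ := A.2
  exact ⟨t, h.imp Subtype.ext Subtype.ext⟩

theorem isLowerSet (A : SegmentTree T) : IsLowerSet A.1 := by
  obtain ⟨t, rfl | rfl⟩ := A.eq_iio_or_eq_iic
  · exact isLowerSet_Iio t
  · exact isLowerSet_Iic t

theorem iic_injective : Function.Injective (iic : T → SegmentTree T) := fun _ _ h =>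
  Set.Iic_injective (congrArg Subtype.val h)

theorem iio_mono : Monotone (iio : T → SegmentTree T) := fun _ _ h => Set.Iio_subset_Iio h

theorem iic_mono : Monotone (iic : T → SegmentTree T) := fun _ _ h => Set.Iic_subset_Iic.2 h

theorem iic_le_iff {t : T} {A : SegmentTree T} : iic t ≤ A ↔ t ∈ A.1 :=
  ⟨fun h => h le_rfl, fun h _ hs => A.isLowerSet hs h⟩

theorem mem_le_or_le (hT : IsTreeOrder T) (A : SegmentTree T) {a b : T} (ha : a ∈ A.1)
    (hb : b ∈ A.1) : a ≤ b ∨ b ≤ a := by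
  obtain ⟨t, rfl | rfl⟩ := A.eq_iio_or_eq_iic
  · exact hT.le_or_le (le_of_lt ha) (le_of_lt hb)
  · exact hT.le_or_le ha hb

theorem le_or_le (hT : IsTreeOrder T) {A B C : SegmentTree T} (hA : A ≤ C) (hB : B ≤ C) :
    A ≤ B ∨ B ≤ A := by
  by_contra! h
  obtain ⟨a, haA, haB⟩ := Set.not_subset.1 h.1
  obtain ⟨b, hbB, hbA⟩ := Set.not_subset.1 h.2
  rcases mem_le_or_le hT C (hA haA) (hB hbB) with h | h
  · exact haB (B.isLowerSet h hbB)
  · exact hbA (A.isLowerSet h haA)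

theorem wellFoundedLT (hT : IsTreeOrder T) : WellFoundedLT (SegmentTree T) := by
  have := hT.wellFoundedLT
  refine ⟨WellFounded.wellFounded_iff_has_min.2 fun S ⟨A, hA⟩ => ?_⟩
  by_cases hmin : ∃ B ∈ S, B < A
  · obtain ⟨B, hB, hBA⟩ := hmin
    obtain ⟨b, hbA, hbB⟩ := Set.exists_of_ssubset hBA
    -- The segment in `S` that omits the earliest possible element of `A` is minimal: a smaller one
    -- would omit an earlier element.
    obtain ⟨t, ⟨C, hC, hCA, htA, htC⟩, ht⟩ := WellFounded.has_min (wellFounded_lt (α := T))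
      {t | ∃ C ∈ S, C < A ∧ t ∈ A.1 ∧ t ∉ C.1} ⟨b, B, hB, hBA, hbA, hbB⟩
    refine ⟨C, hC, fun D hD hDC => ?_⟩
    obtain ⟨c, hcC, hcD⟩ := Set.exists_of_ssubset hDC
    have hcA := hCA.le hcC
    have hct : ¬ t ≤ c := fun h => htC (C.isLowerSet h hcC)
    exact ht c ⟨D, hD, hDC.trans hCA, hcA, hcD⟩
      (((mem_le_or_le hT A htA hcA).resolve_left hct).lt_of_ne fun h => hct h.ge)
  · push Not at hmin
    exact ⟨A, hA, hmin⟩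

theorem isGreatest_Iio_iic (t : T) : IsGreatest (Set.Iio (iic t)) (iio t) := by
  refine ⟨lt_iff.2 ⟨Set.Iio_subset_Iic_self, fun h => lt_irrefl t (h le_rfl)⟩, fun C hC s hs => ?_⟩
  refine (show s ≤ t from le_iff.1 (le_of_lt hC) hs).lt_of_ne ?_
  rintro rfl
  exact (iic_le_iff.2 hs).not_gt (Set.mem_Iio.1 hC)

/-- A segment without an immediate predecessor is not of the form `iic a`, so it is the union of the
`iic a` strictly below it and is determined by its predecessors. -/
theorem exists_isGreatest {A B : SegmentTree T} (h : Set.Iio A = Set.Iio B) (hne : A ≠ B) :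
    ∃ C, IsGreatest (Set.Iio A) C := by
  by_contra! hc
  have key : ∀ {D E : SegmentTree T}, Set.Iio D = Set.Iio E →
      (∀ C, ¬ IsGreatest (Set.Iio D) C) → D ≤ E := by
    intro D E hDE hD a ha
    refine iic_le_iff.1 (Set.mem_Iio.1 (hDE ▸ (iic_le_iff.2 ha).lt_of_ne ?_ : iic a ∈ Set.Iio E)).le
    rintro rfl
    exact hD _ (isGreatest_Iio_iic a)
  exact hne ((key h hc).antisymm (key h.symm (h ▸ hc)))

/-- The union of the chain is a chain of `T`, hence countable, and each proper member is determined
by the first element of the union that it omits. -/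
theorem countable_of_isChain (hT : IsSuslinTree T) (S : Set (SegmentTree T))
    (hS : IsChain (· ≤ ·) S) : S.Countable := by
  have := hT.isTree.wellFoundedLT
  let U : Set T := ⋃ A ∈ S, A.1
  have hU : IsChain (· ≤ ·) U := by
    intro a ha b hb _
    obtain ⟨A, hA, haA⟩ := Set.mem_iUnion₂.1 ha
    obtain ⟨B, hB, hbB⟩ := Set.mem_iUnion₂.1 hb
    rcases hS.total hA hB with h | h
    · exact mem_le_or_le hT.isTree B (h haA) hbB
    · exact mem_le_or_le hT.isTree A haA (h hbB)
  have hmin : ∀ A : {A ∈ S | A.1 ≠ U}, ∃ a ∈ U, a ∉ A.1.1 ∧ ∀ b ∈ U, b ∉ A.1.1 → a ≤ b := by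
    rintro ⟨A, hA, hAU⟩
    have hsub : A.1 ⊆ U := fun a ha => Set.mem_biUnion hA ha
    obtain ⟨a, ⟨haU, haA⟩, ha⟩ := WellFounded.has_min (wellFounded_lt (α := T)) (U \ A.1)
      (Set.nonempty_of_not_subset fun h => hAU (hsub.antisymm h))
    refine ⟨a, haU, haA, fun b hb hbA => ?_⟩
    rcases hU.total haU hb with h | h
    · exact h
    · exact not_lt_iff_le_imp_ge.1 (ha b ⟨hb, hbA⟩) h
  choose f hfU hfA hf using hmin
  have hinj : Function.Injective fun A => (⟨f A, hfU A⟩ : U) := by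
    have key : ∀ A B : {A ∈ S | A.1 ≠ U}, f A = f B → A.1 ≤ B.1 := by
      intro A B hAB a ha
      by_contra haB
      have := hf B a (Set.mem_biUnion A.2.1 ha) haB
      exact hfA A (A.1.isLowerSet (hAB ▸ this) ha)
    intro A B h
    have h : f A = f B := congrArg Subtype.val h
    exact Subtype.ext ((key A B h).antisymm (key B A h.symm))
  have := (hT.countable_of_isChain U hU).to_subtype
  have h1 : {A ∈ S | A.1 ≠ U}.Countable := Set.countable_coe_iff.1 hinj.countable
  have h2 : {A : SegmentTree T | A.1 = U}.Countable :=
    Set.Subsingleton.countable fun A hA B hB => Subtype.ext (hA.trans hB.symm)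
  exact (h1.union h2).mono fun A hA => by
    by_cases h : A.1 = U
    · exact Or.inr h
    · exact Or.inl ⟨hA, h⟩

/-- Both `iio` and `iic` are monotone, so choosing preimages turns an antichain of segments into an
antichain of `T`. -/
theorem countable_of_isAntichain (hT : IsSuslinTree T) (S : Set (SegmentTree T))
    (hS : IsAntichain (· ≤ ·) S) : S.Countable := by
  have key : ∀ g : T → SegmentTree T, Monotone g → (S ∩ Set.range g).Countable := by
    intro g hg
    choose t ht using fun A : (S ∩ Set.range g : Set (SegmentTree T)) => A.2.2
    have hinj : Function.Injective t := fun A B h => Subtype.ext (by rw [← ht A, ← ht B, h])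
    have hanti : IsAntichain (· ≤ ·) (Set.range t) := by
      rintro _ ⟨A, rfl⟩ _ ⟨B, rfl⟩ hAB h
      refine hS A.2.1 B.2.1 (fun h' => hAB (congrArg t (Subtype.ext h'))) ?_
      rw [← ht A, ← ht B]
      exact hg h
    have := (hT.countable_of_isAntichain _ hanti).to_subtype
    exact Set.countable_coe_iff.1 (Set.rangeFactorization_injective.2 hinj).countable
  refine ((key iio iio_mono).union (key iic iic_mono)).mono fun A hA => ?_
  obtain ⟨t, rfl | rfl⟩ := A.eq_iio_or_eq_iic
  · exact Or.inl ⟨hA, t, rfl⟩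
  · exact Or.inr ⟨hA, t, rfl⟩

theorem hausdorffSuslinTree (hT : IsSuslinTree T) : HausdorffSuslinTree (SegmentTree T) where
  wellFoundedLT := wellFoundedLT hT.isTree
  le_or_le := le_or_le hT.isTree
  exists_isGreatest := exists_isGreatest
  uncountable := by
    have : Uncountable T := by
      rw [← Cardinal.aleph0_lt_mk_iff, hT.card_eq]
      exact Cardinal.aleph0_lt_aleph_one
    exact iic_injective.uncountable
  countable_of_isChain := countable_of_isChain hT
  countable_of_isAntichain := countable_of_isAntichain hT
  exists_label := by
    have h : Cardinal.mk (SegmentTree T) ≤ Cardinal.mk (Set.Icc (0 : ℝ) 1) := by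
      rw [Cardinal.mk_Icc_real one_pos]
      have h1 : Function.Surjective (Sum.elim iio iic : T ⊕ T → SegmentTree T) := fun A => by
        obtain ⟨t, rfl | rfl⟩ := A.eq_iio_or_eq_iic
        · exact ⟨Sum.inl t, rfl⟩
        · exact ⟨Sum.inr t, rfl⟩
      refine (Cardinal.mk_le_of_surjective h1).trans ?_
      rw [Cardinal.mk_sum, Cardinal.lift_id, hT.card_eq, Cardinal.add_eq_self
        (Cardinal.aleph0_le_aleph 1)]
      exact Cardinal.aleph_one_le_continuum
    obtain ⟨e⟩ := h
    exact ⟨fun A => e A, Subtype.val_injective.comp e.injective, fun A => (e A).2⟩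

end SegmentTree

theorem theorem3p5 (h : ¬ SuslinHypothesis) :
    ∃ (S : Type) (_ : TopologicalSpace S),
      IsSurface S ∧ IsTypeISpace S ∧ IsOmegaOneCompact S ∧
        ∀ U : CountableOrdinal → Set S, IsTypeISequence U → ∀ D : Set S, ¬ IsDirection U D := by
  obtain ⟨T, _, hT⟩ := not_not.1 h
  have := SegmentTree.hausdorffSuslinTree hT
  exact ⟨TreeSurface (SegmentTree T), inferInstance, TreeSurface.isSurface,
    TreeSurface.isTypeISpace, TreeSurface.isOmegaOneCompact, fun _ => TreeSurface.not_isDirection⟩
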